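/- Lemma. Let $R \to S$ be a faithfully flat homomorphism of commutative rings with $1$, and let $M$ be an $R$-module. If the $S$-module $M \otimes_R S$ is countably generated and projective, then the $R$-module $M$ is countably generated and projective. Here a module is called countably generated if it is generated by a countable (possibly finite) set of elements. -/

import Mathlib

open scoped TensorProduct

/-- A module is countably generated if it is spanned by a countable (possibly finite or empty)
set of elements. -/
def Module.IsCountablyGenerated (R M : Type*) [Semiring R] [AddCommMonoid M] [Module R M] : Prop :=
  ∃ s : Set M, s.Countable ∧ Submodule.span R s = ⊤

/-! Flatness and countable generation of `M` descend directly, so the issue is projectivity, which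
is reached through contents of finite families. Over a projective module contents exist
(`Module.Projective.exists_isContent`), and they contract along a faithfully flat map
(`Submodule.IsContent.descend`), so every initial segment of generators of `M` has a content.
Minimality makes these contents a tower with surjective transitions, a Mittag-Leffler condition: a
vector in one content extends to all generators and defines a functional. Hence `M` is locally
projective, and countably many corrections glue the local liftings into one section of a free cover.
-/

section Generators

/-- Dependent choice along the natural numbers. -/
theorem exists_seq_of_forall_exists_succ {X : Type*} (P : ℕ → X → Prop) (r : ℕ → X → X → Prop)
    {x₀ : X} (h₀ : P 0 x₀) (h : ∀ k x, P k x → ∃ y, P (k + 1) y ∧ r k x y) :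
    ∃ f : ℕ → X, f 0 = x₀ ∧ (∀ k, P k (f k)) ∧ ∀ k, r k (f k) (f (k + 1)) := by
  choose! g hg hr using h
  let f : ℕ → X := fun k ↦ Nat.rec x₀ g k
  have hf : ∀ k, P k (f k) := fun k ↦ by
    induction k with
    | zero => exact h₀
    | succ k ih => exact hg k _ ih
  exact ⟨f, rfl, hf, fun k ↦ hr k _ (hf k)⟩

/-- A linear map can be prescribed on generators as soon as all relations are respected. -/
theorem LinearMap.exists_apply_eq_of_span_eq_top {R M N ι : Type*} [Ring R] [AddCommGroup M]
    [Module R M] [AddCommGroup N] [Module R N] {y : ι → M}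
    (hy : Submodule.span R (Set.range y) = ⊤) (v : ι → N)
    (hv : ∀ c : ι →₀ R, Finsupp.linearCombination R y c = 0 →
      Finsupp.linearCombination R v c = 0) :
    ∃ f : M →ₗ[R] N, ∀ i, f (y i) = v i := by
  have hsurj : Function.Surjective (Finsupp.linearCombination R y) := by
    rw [← LinearMap.range_eq_top, Finsupp.range_linearCombination, hy]
  let e := (Finsupp.linearCombination R y).quotKerEquivOfSurjective hsurj
  refine ⟨(Submodule.liftQ _ (Finsupp.linearCombination R v) fun c hc ↦ hv c hc) ∘ₗ
    e.symm.toLinearMap, fun i ↦ ?_⟩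
  have : e.symm (y i) = Submodule.Quotient.mk (Finsupp.single i 1) := by
    rw [LinearEquiv.symm_apply_eq]
    simp [e]
  simpa [this] using Submodule.liftQ_apply _ (Finsupp.linearCombination R v) (Finsupp.single i 1)

end Generators

/-! ### Contents of finite families and their descent -/

section Content

/-- For a submodule `I` of `ι → R`, the submodule `I • M` of `ι → M` generated by the families
`j ↦ a j • z` with `a ∈ I` and `z : M`. -/
def Submodule.tensorRange {R ι : Type*} [CommRing R] (I : Submodule R (ι → R)) (M : Type*)
    [AddCommGroup M] [Module R M] : Submodule R (ι → M) :=
  Submodule.span R {w | ∃ a ∈ I, ∃ z : M, w = fun j ↦ a j • z}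

/-- `I` is the content of the family `x`: the least submodule `I` with `x ∈ I • M`. -/
def Submodule.IsContent {R ι M : Type*} [CommRing R] [AddCommGroup M] [Module R M]
    (I : Submodule R (ι → R)) (x : ι → M) : Prop :=
  IsLeast {I : Submodule R (ι → R) | x ∈ I.tensorRange M} I

variable {R : Type*} [CommRing R] {M : Type*} [AddCommGroup M] [Module R M] {ι : Type*}

theorem Submodule.smul_mem_tensorRange {I : Submodule R (ι → R)} {a : ι → R} (ha : a ∈ I)
    (z : M) : (fun j ↦ a j • z) ∈ I.tensorRange M :=
  Submodule.subset_span ⟨a, ha, z, rfl⟩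

theorem Submodule.tensorRange_map_funLeft {κ : Type*} (f : κ → ι) {I : Submodule R (ι → R)}
    {x : ι → M} (hx : x ∈ I.tensorRange M) :
    x ∘ f ∈ (I.map (LinearMap.funLeft R R f)).tensorRange M := by
  suffices I.tensorRange M ≤
      ((I.map (LinearMap.funLeft R R f)).tensorRange M).comap (LinearMap.funLeft R M f) from this hx
  refine Submodule.span_le.2 ?_
  rintro _ ⟨a, ha, z, rfl⟩
  exact Submodule.smul_mem_tensorRange (Submodule.mem_map_of_mem ha) z

theorem Submodule.one_tmul_mem_tensorRange {S : Type*} [CommRing S] [Algebra R S]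
    {I : Submodule R (ι → R)} {J : Submodule S (ι → S)}
    (hIJ : ∀ a ∈ I, (fun j ↦ algebraMap R S (a j)) ∈ J) {x : ι → M}
    (hx : x ∈ I.tensorRange M) :
    (fun j ↦ (1 : S) ⊗ₜ[R] x j) ∈ J.tensorRange (S ⊗[R] M) := by
  let f : (ι → M) →ₗ[R] (ι → S ⊗[R] M) := (TensorProduct.mk R S M 1).compLeft ι
  suffices I.tensorRange M ≤ ((J.tensorRange (S ⊗[R] M)).restrictScalars R).comap f from this hx
  refine Submodule.span_le.2 ?_
  rintro _ ⟨a, ha, z, rfl⟩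
  have := Submodule.smul_mem_tensorRange (hIJ a ha) ((1 : S) ⊗ₜ[R] z)
  have hf : f (fun j ↦ a j • z) = fun j ↦ algebraMap R S (a j) • ((1 : S) ⊗ₜ[R] z) := by
    ext j
    simp [f]
  change f _ ∈ J.tensorRange (S ⊗[R] M)
  rwa [hf]

variable [Fintype ι]

/-- Contents exist in projective modules. -/
theorem Module.Projective.exists_isContent [Module.Projective R M] (x : ι → M) :
    ∃ I : Submodule R (ι → R), I.IsContent x := by
  classical
  -- The content is the set of value vectors of all functionals on `x`; a functional carries `I • M`
  -- into `I`, which gives minimality.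
  let F : (M →ₗ[R] R) →ₗ[R] (ι → R) := LinearMap.pi fun j ↦ LinearMap.applyₗ (x j)
  refine ⟨LinearMap.range F, ?_, ?_⟩
  · obtain ⟨s, hs⟩ := (Module.projective_def' (R := R) (P := M)).1 inferInstance
    let T : Finset M := Finset.univ.biUnion fun j ↦ (s (x j)).support
    have hx : x = ∑ z ∈ T, fun j ↦ s (x j) z • z := by
      ext j
      have h := LinearMap.congr_fun hs (x j)
      rw [LinearMap.comp_apply, Finsupp.linearCombination_apply,
        Finsupp.sum_of_support_subset (s := T) _
          (Finset.subset_biUnion_of_mem (fun j ↦ (s (x j)).support) (Finset.mem_univ j)) _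
          (by simp)] at h
      simpa using h.symm
    have hmem : ∀ z, (fun j ↦ s (x j) z) ∈ LinearMap.range F := fun z ↦
      ⟨Finsupp.lapply z ∘ₗ s, rfl⟩
    rw [Set.mem_ofPred_eq, hx]
    exact sum_mem fun z _ ↦ Submodule.smul_mem_tensorRange (hmem z) z
  · rintro I (hI : x ∈ I.tensorRange M) _ ⟨φ, rfl⟩
    suffices I.tensorRange M ≤ I.comap (φ.compLeft ι) from this hI
    refine Submodule.span_le.2 ?_
    rintro _ ⟨a, ha, z, rfl⟩
    have : φ.compLeft ι (fun j ↦ a j • z) = φ z • a := by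
      ext j
      simp [mul_comm]
    change φ.compLeft ι _ ∈ I
    rw [this]
    exact I.smul_mem _ ha

variable [DecidableEq ι]

theorem Submodule.sum_tmul_eq_zero_of_mem_tensorRange {N : Type*} [AddCommGroup N] [Module R N]
    (f : (ι → R) →ₗ[R] N) {x : ι → M} (hx : x ∈ (LinearMap.ker f).tensorRange M) :
    ∑ j, f (Pi.single j 1) ⊗ₜ[R] x j = 0 := by
  let g : (ι → M) →ₗ[R] N ⊗[R] M :=
    ∑ j, TensorProduct.mk R N M (f (Pi.single j 1)) ∘ₗ LinearMap.proj j
  suffices (LinearMap.ker f).tensorRange M ≤ LinearMap.ker g by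
    simpa [g] using this hx
  refine Submodule.span_le.2 ?_
  rintro _ ⟨a, ha, z, rfl⟩
  have : ∑ j, f (Pi.single j 1) ⊗ₜ[R] (a j • z) = f a ⊗ₜ[R] z := by
    rw [LinearMap.pi_apply_eq_sum_univ f a, TensorProduct.sum_tmul]
    refine Finset.sum_congr rfl fun j _ ↦ ?_
    rw [TensorProduct.smul_tmul]
    congr 2
    ext i
    simp [Pi.single_apply, eq_comm]
  simpa [g, LinearMap.mem_ker.1 ha] using this

/-- Flatness keeps `ker f → R^ι → N` exact after tensoring with `M`. -/
theorem Submodule.mem_tensorRange_ker [Module.Flat R M] {N : Type*} [AddCommGroup N] [Module R N]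
    (f : (ι → R) →ₗ[R] N) {x : ι → M} (hx : ∑ j, f (Pi.single j 1) ⊗ₜ[R] x j = 0) :
    x ∈ (LinearMap.ker f).tensorRange M := by
  have hex := Module.Flat.rTensor_exact M (LinearMap.exact_subtype_ker_map f)
  obtain ⟨t, ht⟩ := (hex (∑ j, (Pi.single j 1 : ι → R) ⊗ₜ[R] x j)).1 (by simpa using hx)
  let g : (ι → R) ⊗[R] M →ₗ[R] (ι → M) :=
    TensorProduct.lift (LinearMap.mk₂ R (fun a z j ↦ a j • z)
      (fun _ _ _ ↦ by ext; simp [add_smul]) (fun _ _ _ ↦ by ext; simp [mul_smul])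
      (fun _ _ _ ↦ by ext; simp) (fun _ _ _ ↦ funext fun _ ↦ smul_comm _ _ _))
  have hg : ∀ s, g ((LinearMap.ker f).subtype.rTensor M s) ∈ (LinearMap.ker f).tensorRange M := by
    intro s
    induction s with
    | zero => simp
    | tmul a z => exact Submodule.smul_mem_tensorRange a.2 z
    | add s t hs ht => simpa using add_mem hs ht
  have hx' : g (∑ j, (Pi.single j 1 : ι → R) ⊗ₜ[R] x j) = x := by
    ext i
    simp [g, Pi.single_apply]
  rw [← hx', ← ht]
  exact hg t

/-- If `M` is flat and `1 ⊗ x` lies in `J • (S ⊗ M)`, then `x` lies in `I • M` for the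
contraction `I` of `J` to `ι → R`. -/
theorem Submodule.mem_tensorRange_comap [Module.Flat R M] {S : Type*} [CommRing S] [Algebra R S]
    (J : Submodule S (ι → S)) {x : ι → M}
    (hx : (fun j ↦ (1 : S) ⊗ₜ[R] x j) ∈ J.tensorRange (S ⊗[R] M)) :
    x ∈ ((J.restrictScalars R).comap ((Algebra.linearMap R S).compLeft ι)).tensorRange M := by
  let f : (ι → R) →ₗ[R] (ι → S) ⧸ J :=
    (J.mkQ.restrictScalars R) ∘ₗ (Algebra.linearMap R S).compLeft ι
  have hker : (J.restrictScalars R).comap ((Algebra.linearMap R S).compLeft ι) =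
      LinearMap.ker f := by
    ext a
    simp [f]
  rw [hker]
  refine Submodule.mem_tensorRange_ker f ?_
  rw [← J.ker_mkQ] at hx
  have h := Submodule.sum_tmul_eq_zero_of_mem_tensorRange J.mkQ hx
  have h' := congrArg (TensorProduct.AlgebraTensorModule.cancelBaseChange R S S _ M) h
  simp only [map_sum, TensorProduct.AlgebraTensorModule.cancelBaseChange_tmul, one_smul,
    map_zero] at h'
  rw [← h']
  refine Finset.sum_congr rfl fun j _ ↦ ?_
  congr 1
  simp only [f, LinearMap.comp_apply, LinearMap.restrictScalars_apply]
  congr 1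
  ext i
  by_cases hij : i = j
  · subst hij; simp
  · simp [hij]

/-- Contents descend along faithfully flat ring homomorphisms. -/
theorem Submodule.IsContent.descend (S : Type*) [CommRing S] [Algebra R S]
    [Module.FaithfullyFlat R S] [Module.Flat R M] {x : ι → M} {J : Submodule S (ι → S)}
    (hJ : J.IsContent fun j ↦ (1 : S) ⊗ₜ[R] x j) :
    ((J.restrictScalars R).comap ((Algebra.linearMap R S).compLeft ι)).IsContent x := by
  refine ⟨Submodule.mem_tensorRange_comap J hJ.1, fun I (hI : x ∈ I.tensorRange M) a ha ↦ ?_⟩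
  -- `Ψ` is the base change of `I.mkQ`. Minimality of `J` gives `J ≤ ker Ψ`, and faithful flatness
  -- removes the factor `1 ⊗`.
  let Ψ : (ι → S) →ₗ[S] S ⊗[R] ((ι → R) ⧸ I) :=
    ∑ j, LinearMap.toSpanSingleton S _ ((1 : S) ⊗ₜ[R] I.mkQ (Pi.single j 1)) ∘ₗ LinearMap.proj j
  have hΨ : ∀ b : ι → R, Ψ (fun j ↦ algebraMap R S (b j)) = (1 : S) ⊗ₜ[R] I.mkQ b := by
    intro b
    rw [LinearMap.pi_apply_eq_sum_univ I.mkQ b, TensorProduct.tmul_sum]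
    simp only [Ψ, LinearMap.sum_apply, LinearMap.comp_apply, LinearMap.proj_apply,
      LinearMap.toSpanSingleton_apply]
    refine Finset.sum_congr rfl fun j _ ↦ ?_
    rw [algebraMap_smul, ← TensorProduct.tmul_smul]
    congr 3
    ext i
    simp [Pi.single_apply, eq_comm]
  have hle : J ≤ LinearMap.ker Ψ := hJ.2 <| Submodule.one_tmul_mem_tensorRange
    (fun b hb ↦ by
      rw [LinearMap.mem_ker, hΨ, Submodule.mkQ_apply, (Submodule.Quotient.mk_eq_zero I).2 hb,
        TensorProduct.tmul_zero]) hI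
  have h0 : (1 : S) ⊗ₜ[R] I.mkQ a = 0 := by
    rw [← hΨ]
    exact hle ha
  rw [Module.FaithfullyFlat.one_tmul_eq_zero_iff] at h0
  exact (Submodule.Quotient.mk_eq_zero I).1 h0

/-- Every linear relation between the entries of `x` holds in the content of `x`. -/
theorem Submodule.IsContent.sum_mul_eq_zero [Module.Flat R M] {x : ι → M}
    {I : Submodule R (ι → R)} (hI : I.IsContent x) {r : ι → R} (hr : ∑ j, r j • x j = 0)
    {a : ι → R} (ha : a ∈ I) : ∑ j, r j * a j = 0 := by
  let f : (ι → R) →ₗ[R] R := ∑ j, r j • LinearMap.proj j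
  have hf : ∀ j, f (Pi.single j 1) = r j := fun j ↦ by simp [f, Pi.single_apply]
  have hx : x ∈ (LinearMap.ker f).tensorRange M := by
    refine Submodule.mem_tensorRange_ker f ((TensorProduct.lid R M).injective ?_)
    simpa [hf] using hr
  simpa [f] using hI.2 hx ha

end Content

/-! ### From contents to projectivity -/

section CountablyGenerated

variable {R M : Type*} [CommRing R] [AddCommGroup M] [Module R M]

/-- Over a countably generated flat module in which contents exist, every element of the content of
an initial segment of the generators is the value of a linear functional. -/
theorem Submodule.IsContent.exists_functional [Module.Flat R M] {y : ℕ → M}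
    (hy : Submodule.span R (Set.range y) = ⊤) {c : ∀ n, Submodule R (Fin n → R)}
    (hc : ∀ n, (c n).IsContent fun j : Fin n ↦ y j) {n : ℕ} {a : Fin n → R} (ha : a ∈ c n) :
    ∃ φ : M →ₗ[R] R, ∀ j : Fin n, φ (y j) = a j := by
  have hmap : ∀ m, c m ≤ (c (m + 1)).map (LinearMap.funLeft R R Fin.castSucc) := fun m ↦
    (hc m).2 (Submodule.tensorRange_map_funLeft Fin.castSucc (hc (m + 1)).1)
  -- Only the first `n + k` entries of stage `k` matter; the zeros beyond are padding.
  obtain ⟨b, hb0, hbc, hbs⟩ := exists_seq_of_forall_exists_succ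
    (fun k (b : ℕ → R) ↦ (fun j : Fin (n + k) ↦ b j) ∈ c (n + k))
    (fun k b b' ↦ ∀ i < n + k, b' i = b i)
    (x₀ := fun i ↦ if h : i < n then a ⟨i, h⟩ else 0) (by simpa using ha)
    (fun k b hb ↦ by
      obtain ⟨b', hb', h⟩ := hmap _ hb
      refine ⟨fun i ↦ if h : i < n + k + 1 then b' ⟨i, h⟩ else 0, ?_, fun i hi ↦ ?_⟩
      · have : (fun j : Fin (n + k + 1) ↦ if h : (j : ℕ) < n + k + 1 then b' ⟨j, h⟩ else 0) = b' :=
          funext fun j ↦ dif_pos j.2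
        exact this.symm ▸ hb'
      · have := congrFun h ⟨i, hi⟩
        simp only [LinearMap.funLeft_apply] at this
        rw [← this]
        exact dif_pos (by omega))
  have hstab : ∀ k i, i < n + k → ∀ l, b (k + l) i = b k i := by
    intro k i hi l
    induction l with
    | zero => rfl
    | succ l ih => rw [← ih]; exact hbs (k + l) i (by omega)
  -- Entry `i` is settled by stage `i + 1`. A relation involves finitely many generators, so it
  -- holds in some content.
  obtain ⟨φ, hφ⟩ := LinearMap.exists_apply_eq_of_span_eq_top hy (fun i ↦ b (i + 1) i) (by
    intro r hr
    obtain ⟨k, hk⟩ := r.support.exists_nat_subset_range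
    have hsub : r.support ⊆ Finset.range (n + k) :=
      hk.trans (Finset.range_subset_range.2 (by omega))
    rw [Finsupp.linearCombination_apply, Finsupp.sum_of_support_subset _ hsub _ (by simp),
      Finset.sum_range] at hr ⊢
    rw [← (hc (n + k)).sum_mul_eq_zero hr (hbc k)]
    refine Finset.sum_congr rfl fun j _ ↦ ?_
    rw [smul_eq_mul]
    congr 1
    rcases le_total (j + 1 : ℕ) k with h | h
    · obtain ⟨l, hl⟩ := Nat.exists_eq_add_of_le h
      have := hstab (j + 1) j (by omega) l
      rw [← hl] at this
      exact this.symm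
    · obtain ⟨l, hl⟩ := Nat.exists_eq_add_of_le h
      rw [hl]
      exact hstab _ _ j.2 l)
  refine ⟨φ, fun j ↦ ?_⟩
  rw [hφ]
  have := hstab 0 j (by omega) (j + 1)
  rw [zero_add] at this
  simp [this, hb0]

/-- A module is locally projective if the identity lifts, on every finite subset, to a linear map
into a free module. -/
def Module.IsLocallyProjective (R M : Type*) [CommRing R] [AddCommGroup M] [Module R M] : Prop :=
  ∀ T : Finset M, ∃ h : M →ₗ[R] M →₀ R, ∀ x ∈ T, Finsupp.linearCombination R id (h x) = x

/-- Since the segment lies in `c n • M`, it is a sum of families `a j • z` with `a ∈ c n`; each such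
`a` comes from a functional `φ`, and the maps `z ⊗ φ` add up to the lifting. -/
theorem Module.IsLocallyProjective.of_isContent [Module.Flat R M] {y : ℕ → M}
    (hy : Submodule.span R (Set.range y) = ⊤)
    (hc : ∀ n, ∃ c : Submodule R (Fin n → R), c.IsContent fun j : Fin n ↦ y j) :
    Module.IsLocallyProjective R M := by
  choose c hc using hc
  have key : ∀ n, ∀ w ∈ (c n).tensorRange M, ∃ h : M →ₗ[R] M →₀ R,
      ∀ j : Fin n, Finsupp.linearCombination R id (h (y j)) = w j := by
    intro n w hw
    induction hw using Submodule.span_induction with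
    | mem w hw =>
      obtain ⟨a, ha, z, rfl⟩ := hw
      obtain ⟨φ, hφ⟩ := Submodule.IsContent.exists_functional hy hc ha
      exact ⟨Finsupp.lsingle z ∘ₗ φ, fun j ↦ by simp [hφ]⟩
    | zero => exact ⟨0, by simp⟩
    | add w w' _ _ hw hw' =>
      obtain ⟨h, hh⟩ := hw
      obtain ⟨h', hh'⟩ := hw'
      exact ⟨h + h', fun j ↦ by simp [hh, hh']⟩
    | smul r w _ hw =>
      obtain ⟨h, hh⟩ := hw
      exact ⟨r • h, fun j ↦ by simp [hh]⟩
  intro T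
  have hmono : Monotone fun n ↦ Submodule.span R (y '' Set.Iio n) := fun m n h ↦
    Submodule.span_mono (Set.image_mono (Set.Iio_subset_Iio h))
  have hmem : ∀ x : M, ∃ n, x ∈ Submodule.span R (y '' Set.Iio n) := by
    intro x
    rw [← Submodule.mem_iSup_of_directed _ hmono.directed_le, ← Submodule.span_iUnion,
      ← Set.image_iUnion, Set.iUnion_Iio, Set.image_univ, hy]
    trivial
  choose N hN using hmem
  obtain ⟨h, hh⟩ := key (T.sup N) _ (hc (T.sup N)).1
  refine ⟨h, fun x hx ↦ ?_⟩
  have hxs := hmono (Finset.le_sup (f := N) hx) (hN x)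
  refine LinearMap.eqOn_span (f := Finsupp.linearCombination R id ∘ₗ h) (g := LinearMap.id)
    ?_ hxs
  rintro _ ⟨i, hi, rfl⟩
  exact hh ⟨i, hi⟩

/-- A countably generated locally projective module is projective. -/
theorem Module.IsLocallyProjective.projective (hM : Module.IsLocallyProjective R M) {y : ℕ → M}
    (hy : Submodule.span R (Set.range y) = ⊤) : Module.Projective R M := by
  classical
  obtain ⟨h, -, hid, hs⟩ := exists_seq_of_forall_exists_succ
    (fun k (h : M →ₗ[R] M →₀ R) ↦ ∀ i < k, Finsupp.linearCombination R id (h (y i)) = y i)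
    (fun k h h' ↦ ∀ i < k, h' (y i) = h (y i)) (x₀ := 0) (by simp)
    (fun k h hh ↦ by
      -- The error `d` vanishes on the generators already lifted, so adding `g ∘ d` keeps their
      -- values and repairs the next one.
      let d : M →ₗ[R] M := LinearMap.id - Finsupp.linearCombination R id ∘ₗ h
      obtain ⟨g, hg⟩ := hM ((Finset.range (k + 1)).image fun i ↦ d (y i))
      refine ⟨h + g ∘ₗ d, fun i hi ↦ ?_, fun i hi ↦ ?_⟩
      · rw [LinearMap.add_apply, map_add, LinearMap.comp_apply,
          hg _ (Finset.mem_image_of_mem _ (Finset.mem_range.2 hi))]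
        simp [d]
      · simp [d, hh i hi])
  have hstab : ∀ k i, i < k → ∀ l, h (k + l) (y i) = h k (y i) := by
    intro k i hi l
    induction l with
    | zero => rfl
    | succ l ih => rw [← ih]; exact hs (k + l) i (by omega)
  obtain ⟨H, hH⟩ := LinearMap.exists_apply_eq_of_span_eq_top hy (fun i ↦ h (i + 1) (y i)) (by
    intro r hr
    obtain ⟨k, hk⟩ := r.support.exists_nat_subset_range
    have : Finsupp.linearCombination R (fun i ↦ h (i + 1) (y i)) r =
        h k (Finsupp.linearCombination R y r) := by
      rw [Finsupp.linearCombination_apply, Finsupp.linearCombination_apply, Finsupp.sum,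
        Finsupp.sum, map_sum]
      refine Finset.sum_congr rfl fun i hi ↦ ?_
      obtain ⟨l, rfl⟩ := Nat.exists_eq_add_of_le (Nat.succ_le_of_lt (Finset.mem_range.1 (hk hi)))
      rw [map_smul, hstab (i + 1) i (by omega) l]
    rw [this, hr, map_zero])
  rw [Module.projective_def']
  refine ⟨H, LinearMap.ext_on_range hy fun i ↦ ?_⟩
  simpa [hH] using hid (i + 1) i (by omega)

theorem Module.IsCountablyGenerated.exists_seq (h : Module.IsCountablyGenerated R M) :
    ∃ y : ℕ → M, Submodule.span R (Set.range y) = ⊤ := by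
  obtain ⟨s, hs, hspan⟩ := h
  obtain ⟨y, hy⟩ := (hs.insert 0).exists_eq_range (Set.insert_nonempty 0 s)
  exact ⟨y, by rw [← hy, Submodule.span_insert_zero, hspan]⟩

/-- Countable generation descends along faithfully flat ring homomorphisms. -/
theorem Module.IsCountablyGenerated.descend {S : Type*} [CommRing S] [Algebra R S]
    [Module.FaithfullyFlat R S] (h : Module.IsCountablyGenerated S (S ⊗[R] M)) :
    Module.IsCountablyGenerated R M := by
  obtain ⟨s, hs, hspan⟩ := h
  have hfin : ∀ t : S ⊗[R] M, ∃ T : Finset M,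
      t ∈ Submodule.span S (TensorProduct.mk R S M 1 '' T) := by
    intro t
    obtain ⟨c, rfl⟩ := TensorProduct.exists_finsupp_right t
    refine ⟨c.support, sum_mem fun m hm ↦ ?_⟩
    have : c m ⊗ₜ[R] m = c m • TensorProduct.mk R S M 1 m := by
      simp [TensorProduct.smul_tmul']
    simp only [this]
    exact Submodule.smul_mem _ _ (Submodule.subset_span ⟨m, hm, rfl⟩)
  choose T hT using hfin
  refine ⟨⋃ t ∈ s, (T t : Set M), hs.biUnion fun t _ ↦ (T t).countable_toSet, ?_⟩
  -- Each generator of `S ⊗ M` involves finitely many elements of `M`; their span becomes everything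
  -- over `S`, hence is everything.
  apply Submodule.baseChange_injective (A := S)
  rw [Submodule.baseChange_span, Submodule.baseChange_top, eq_top_iff, ← hspan,
    Submodule.span_le]
  intro t ht
  exact Submodule.span_mono (Set.image_mono (Set.subset_biUnion_of_mem ht)) (hT t)

end CountablyGenerated

theorem mainTheorem11 {R S M : Type*} [CommRing R] [CommRing S] [Algebra R S]
    [Module.FaithfullyFlat R S] [AddCommGroup M] [Module R M]
    (hcg : Module.IsCountablyGenerated S (S ⊗[R] M))
    (hproj : Module.Projective S (S ⊗[R] M)) :
    Module.IsCountablyGenerated R M ∧ Module.Projective R M := by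
  have hM : Module.IsCountablyGenerated R M := hcg.descend
  have : Module.Flat R M := Module.Flat.of_flat_tensorProduct R M S
  obtain ⟨y, hy⟩ := hM.exists_seq
  refine ⟨hM, (Module.IsLocallyProjective.of_isContent hy fun n ↦ ?_).projective hy⟩
  obtain ⟨J, hJ⟩ := Module.Projective.exists_isContent (R := S)
    fun j : Fin n ↦ (1 : S) ⊗ₜ[R] y j
  exact ⟨_, hJ.descend S⟩
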